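/- **Setting.** A stochastic bipartite graph $G=(U,V,E)$ consists of finite sets $U$ (offline vertices) and $V$ (online vertices), $E=U\times V$, and for every edge $e\in E$ a probability $p_e\in[0,1]$ and a weight $w_e\in\mathbb R$, and for every $v\in V$ a patience $\ell_v\in\{0,1,2,\dots\}$. Each edge $e$ is active with probability $p_e$, independently of the other edges, and inactive otherwise. A (possibly randomized) *probing algorithm* knows $G$ and adaptively probes edges one at a time, in any order. A probe reveals whether the edge is active. The next edge to probe, or the decision to halt, may depend on all outcomes so far and on internal randomness independent of the edge states. No edge is probed twice, and for each $v\in V$ at most $\ell_v$ edges containing $v$ are probed. The algorithm builds a matching, initially empty, and must respect commitment: if a probed edge $(u,v)$ is active and $u$ and $v$ are both currently unmatched, then $(u,v)$ is added to the matching; otherwise the matching does not change. The value of the algorithm is the expected total weight of its final matching. The committal benchmark value $\mathrm{OPT}(G)$ is the largest value of a probing algorithm on $G$. For $v\in V$ let $U^{(\le \ell_v)}$ be the set of tuples $\boldsymbol u=(u_1,\dots,u_k)$ of pairwise distinct elements of $U$ with $1\le k\le \ell_v$; write $|\boldsymbol u|=k$ and $$g_v^i(\boldsymbol u)=p_{u_i,v}\prod_{j=1}^{i-1}(1-p_{u_j,v}),\qquad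 1\le i\le k .$$ Let $\mathrm{LPOPT}_{new}(G)$ be the optimum value of the linear program in the variables $x_v(\boldsymbol u)$, $v\in V$, $\boldsymbol u\in U^{(\le \ell_v)}$: $$\begin{aligned} \text{maximize}\quad & \sum_{v\in V}\ \sum_{\boldsymbol u\in U^{(\le \ell_v)}}\Bigl(\sum_{i=1}^{|\boldsymbol u|} w_{u_i,v}\,g_v^i(\boldsymbol u)\Bigr)x_v(\boldsymbol u)\\ \text{subject to}\quad & \sum_{v\in V}\ \sum_{i=1}^{\ell_v}\ \sum_{\substack{\boldsymbol u^*\in U^{(\le \ell_v)}:\\ |\boldsymbol u^*|\ge i,\ u^*_i=u}} g_v^i(\boldsymbol u^*)\,x_v(\boldsymbol u^*)\le 1 && \forall u\in U,\\ & \sum_{\boldsymbol u\in U^{(\le \ell_v)}} x_v(\boldsymbol u)\le 1 && \forall v\in V,\\ & x_v(\boldsymbol u)\ge 0 && \forall v\in V,\ \boldsymbol u\in U^{(\le \ell_v)} . \end{aligned}$$ **Theorem.** For every stochastic bipartite graph $G$, both maxima $\mathrm{OPT}(G)$ and $\mathrm{LPOPT}_{new}(G)$ are attained, and $$\mathrm{OPT}(G)\le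 \mathrm{LPOPT}_{new}(G).$$ -/

import Mathlib

/-- A stochastic bipartite graph with offline vertices `U`, online vertices `V` and edge set
`U × V`: every edge `e` has a probability `p e` of being active and a weight `w e`, and every
online vertex `v` has a patience `ℓ v`. A pair that is not an edge is given probability `0`. -/
structure StochasticGraph (U V : Type*) where
  p : U × V → ℝ
  w : U × V → ℝ
  ℓ : V → ℕ
  p_nonneg : ∀ e, 0 ≤ p e
  p_le_one : ∀ e, p e ≤ 1

/-- A deterministic adaptive plan for probing edges, as a decision tree: either halt, or probe
an edge and continue in a way that depends on whether it is found inactive or active. -/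
inductive ProbingTree (U V : Type*) where
  | halt : ProbingTree U V
  | probe (e : U × V) (ifInactive ifActive : ProbingTree U V) : ProbingTree U V

namespace ProbingTree

variable {U V : Type*}

/-- The sequence of edges that are probed when the edge states are `st`
(`st e = true` means that `e` is active). -/
def probes (st : U × V → Bool) : ProbingTree U V → List (U × V)
  | halt => []
  | probe e a b => e :: (if st e then probes st b else probes st a)

variable [DecidableEq U] [DecidableEq V]

/-- The effect on the current matching `M` of a probe that finds `e` active: `e` must be added
if both of its endpoints are currently unmatched, and otherwise `M` does not change. -/
def commit (M : Finset (U × V)) (e : U × V) : Finset (U × V) :=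
  if ∀ f ∈ M, f.1 ≠ e.1 ∧ f.2 ≠ e.2 then insert e M else M

/-- The final matching when the tree is executed on the edge states `st`, starting from the
current matching `M` and respecting commitment. -/
def run (st : U × V → Bool) : ProbingTree U V → Finset (U × V) → Finset (U × V)
  | halt, M => M
  | probe e a b, M => if st e then run st b (commit M e) else run st a M

end ProbingTree

namespace StochasticGraph

variable {U V : Type*} [DecidableEq V] (G : StochasticGraph U V)

/-- Whatever the edge states are, no edge is probed twice, and at most `ℓ v` probes
are made to the edges at each online vertex `v`. -/
def Respects (t : ProbingTree U V) : Prop :=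
  ∀ st : U × V → Bool, (t.probes st).Nodup ∧
    ∀ v : V, (t.probes st).countP (fun e => decide (e.2 = v)) ≤ G.ℓ v

/-- The deterministic (offline, adaptive) probing algorithms for `G`. -/
def DetAlgorithm : Type _ := {t : ProbingTree U V // G.Respects t}

/-- The (offline, adaptive, possibly randomized) probing algorithms for `G`. The internal
randomness, which is independent of the edge states, is drawn before the execution. -/
abbrev Algorithm : Type _ := PMF G.DetAlgorithm

variable [Fintype U] [Fintype V]

/-- The probability that the edge states are `st`, when every edge `e` is active independently
with probability `p e`. -/
noncomputable def stateProb (st : U × V → Bool) : ℝ :=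
  ∏ e, if st e then G.p e else 1 - G.p e

variable [DecidableEq U]

/-- The expected weight of the matching of a deterministic probing algorithm. -/
noncomputable def detValue (A : G.DetAlgorithm) : ℝ :=
  ∑ st : U × V → Bool, G.stateProb st * ∑ e ∈ A.1.run st ∅, G.w e

/-- The expected weight of the matching of a probing algorithm. -/
noncomputable def value (A : G.Algorithm) : ℝ :=
  ∑' D : G.DetAlgorithm, (A D).toReal * G.detValue D

/-- The value of the committal benchmark: the largest expected value of a probing algorithm. -/
noncomputable def OPT : ℝ := sSup (Set.range G.value)

end StochasticGraph

/-- The tuples of length between `1` and `n` with pairwise distinct entries in `U`. -/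
def ProbeSeq (U : Type*) (n : ℕ) : Type _ :=
  {s : List U // s.Nodup ∧ 1 ≤ s.length ∧ s.length ≤ n}

noncomputable instance (U : Type*) [Fintype U] [DecidableEq U] (n : ℕ) :
    Fintype (ProbeSeq U n) :=
  Fintype.ofInjective
    (fun s : ProbeSeq U n => (⟨s.1, s.2.1⟩ : {l : List U // l.Nodup}))
    (fun _ _ h => Subtype.ext (congrArg (fun l => l.1) h))

namespace StochasticGraph

variable {U V : Type*} (G : StochasticGraph U V)

/-- The probability that the `i`-th edge (counted from `0`) is the first active one when the
edges between `v` and the entries of `s` are revealed in order. -/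
noncomputable def g (v : V) (s : List U) (i : Fin s.length) : ℝ :=
  G.p (s.get i, v) * ∏ j ∈ Finset.univ.filter (fun j => j < i), (1 - G.p (s.get j, v))

/-- The variables of the linear program. -/
abbrev LPVar : Type _ := (v : V) → ProbeSeq U (G.ℓ v) → ℝ

variable [Fintype U] [DecidableEq U] [Fintype V]

/-- The objective function of the linear program. -/
noncomputable def lpObjective (x : G.LPVar) : ℝ :=
  ∑ v, ∑ s : ProbeSeq U (G.ℓ v),
    (∑ i : Fin s.1.length, G.w (s.1.get i, v) * G.g v s.1 i) * x v s

/-- The constraints of the linear program. -/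
structure LPFeasible (x : G.LPVar) : Prop where
  offline : ∀ u : U, ∑ v, ∑ s : ProbeSeq U (G.ℓ v),
    ∑ i ∈ Finset.univ.filter (fun i : Fin s.1.length => s.1.get i = u),
      G.g v s.1 i * x v s ≤ 1
  online : ∀ v : V, ∑ s : ProbeSeq U (G.ℓ v), x v s ≤ 1
  nonneg : ∀ (v : V) (s : ProbeSeq U (G.ℓ v)), 0 ≤ x v s

/-- The optimum value of the linear program. -/
noncomputable def LPOPT : ℝ := sSup (G.lpObjective '' {x | G.LPFeasible x})

end StochasticGraph

/-! Fix a deterministic tree and an online vertex `v`. Run the tree, but pretend that every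
effective probe at `v` finds an inactive edge; `lpSolution` records the law of the resulting list of
probes. This fictitious run never looks at the states of the edges in its list, and the real run
gains at `v` exactly the first active edge of the list, since afterwards no probe at `v` is
effective. Hence, for every weighting `W`, the expected gain at `v` is the mean of `starValue W v`
over the list; summing over `v` gives `expWeight_eq`. Taking `W = G.w` identifies the value of the
tree with the LP objective at `lpSolution`. Taking for `W` the indicator of the edges at `u` turns
the left side of the offline constraint into the expected number of matching edges at `u`, which is
at most 1. The online constraint is a bound by total probability. Randomized algorithms average over
finitely many trees, so some tree is optimal; the LP maximum exists by compactness. -/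

namespace ProbingTree

/-! ### Decision trees: locality and bounded depth -/

variable {U V : Type*}

/-- No edge is probed twice, whatever the edge states are. -/
def NoRepeat (t : ProbingTree U V) : Prop := ∀ st, (t.probes st).Nodup

/-- An execution consults only the states of the edges that it probes. -/
theorem probes_congr {st st' : U × V → Bool} (t : ProbingTree U V)
    (h : ∀ e ∈ t.probes st, st' e = st e) : t.probes st' = t.probes st := by
  induction t with
  | halt => rfl
  | probe e a b iha ihb =>
    have he : st' e = st e := h e (by simp [probes])
    cases hs : st e with
    | true =>
      have hb := ihb fun f hf => h f (by simp [probes, hs, hf])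
      simp [probes, he, hs, hb]
    | false =>
      have ha := iha fun f hf => h f (by simp [probes, hs, hf])
      simp [probes, he, hs, ha]

/-- The length of a longest path through the tree. -/
def depth : ProbingTree U V → ℕ
  | halt => 0
  | probe _ a b => max (depth a) (depth b) + 1

theorem finite_depth_le [Finite U] [Finite V] (n : ℕ) :
    {t : ProbingTree U V | t.depth ≤ n}.Finite := by
  induction n with
  | zero =>
    refine (Set.finite_singleton halt).subset fun t ht => ?_
    cases t with
    | halt => rfl
    | probe e a b => simp [depth] at ht
  | succ n ih =>
    refine (((Set.finite_univ (α := U × V)).prod (ih.prod ih)).image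
      (fun q => probe q.1 q.2.1 q.2.2) |>.insert halt).subset fun t ht => ?_
    cases t with
    | halt => exact Set.mem_insert _ _
    | probe e a b =>
      simp only [depth, Set.mem_ofPred_eq, Nat.add_le_add_iff_right, max_le_iff] at ht
      exact Set.mem_insert_of_mem _ ⟨(e, a, b), ⟨Set.mem_univ _, ht⟩, rfl⟩

variable [DecidableEq U] [DecidableEq V]

theorem run_congr {st st' : U × V → Bool} (t : ProbingTree U V)
    (h : ∀ e ∈ t.probes st, st' e = st e) (M : Finset (U × V)) :
    t.run st' M = t.run st M := by
  induction t generalizing M with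
  | halt => rfl
  | probe e a b iha ihb =>
    have he : st' e = st e := h e (by simp [probes])
    cases hs : st e with
    | true =>
      have hb := ihb fun f hf => h f (by simp [probes, hs, hf])
      simp [run, he, hs, hb]
    | false =>
      have ha := iha fun f hf => h f (by simp [probes, hs, hf])
      simp [run, he, hs, ha]

theorem probes_update {st : U × V → Bool} {e : U × V} {c : Bool} {t : ProbingTree U V}
    (h : e ∉ t.probes st) : t.probes (Function.update st e c) = t.probes st :=
  probes_congr t fun f hf => Function.update_of_ne (by rintro rfl; exact h hf) _ _

theorem run_update {st : U × V → Bool} {e : U × V} {c : Bool} {t : ProbingTree U V}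
    (h : e ∉ t.probes st) (M : Finset (U × V)) :
    t.run (Function.update st e c) M = t.run st M :=
  run_congr t (fun f hf => Function.update_of_ne (by rintro rfl; exact h hf) _ _) M

namespace NoRepeat

variable {e : U × V} {a b : ProbingTree U V}

/-- With `e` forced inactive the whole tree probes `e` and then runs `a`, so `a` cannot probe `e`
again. Restoring the state of `e` is then invisible to `a`. -/
theorem notMem_ifInactive (h : (probe e a b).NoRepeat) (st : U × V → Bool) :
    e ∉ a.probes st := by
  have h1 := h (Function.update st e false)
  simp only [probes, Function.update_self, Bool.false_eq_true, if_false, List.nodup_cons] at h1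
  have h2 := probes_update (c := st e) h1.1
  rw [Function.update_idem, Function.update_eq_self] at h2
  exact h2 ▸ h1.1

theorem notMem_ifActive (h : (probe e a b).NoRepeat) (st : U × V → Bool) :
    e ∉ b.probes st := by
  have h1 := h (Function.update st e true)
  simp only [probes, Function.update_self, if_true, List.nodup_cons] at h1
  have h2 := probes_update (c := st e) h1.1
  rw [Function.update_idem, Function.update_eq_self] at h2
  exact h2 ▸ h1.1

theorem probes_update_false (h : (probe e a b).NoRepeat) (st : U × V → Bool) :
    (probe e a b).probes (Function.update st e false) = e :: a.probes st := by
  simp [probes, probes_update (h.notMem_ifInactive st)]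

theorem probes_update_true (h : (probe e a b).NoRepeat) (st : U × V → Bool) :
    (probe e a b).probes (Function.update st e true) = e :: b.probes st := by
  simp [probes, probes_update (h.notMem_ifActive st)]

theorem ifInactive (h : (probe e a b).NoRepeat) : a.NoRepeat := fun st => by
  have := h (Function.update st e false)
  rw [h.probes_update_false, List.nodup_cons] at this
  exact this.2

theorem ifActive (h : (probe e a b).NoRepeat) : b.NoRepeat := fun st => by
  have := h (Function.update st e true)
  rw [h.probes_update_true, List.nodup_cons] at this
  exact this.2

end NoRepeat

/-- Below the root its edge is no longer available, so each level uses up one element of `S`. -/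
theorem NoRepeat.depth_le {t : ProbingTree U V} (h : t.NoRepeat) {S : Finset (U × V)}
    (hS : ∀ st, ∀ e ∈ t.probes st, e ∈ S) : t.depth ≤ S.card := by
  induction t generalizing S with
  | halt => exact Nat.zero_le _
  | probe e a b iha ihb =>
    have he : e ∈ S := hS (fun _ => true) e (by simp [probes])
    have ha := iha h.ifInactive (S := S.erase e) fun st f hf =>
      Finset.mem_erase.2 ⟨fun hfe => h.notMem_ifInactive st (hfe ▸ hf),
        hS (Function.update st e false) f (by simp [h.probes_update_false, hf])⟩
    have hb := ihb h.ifActive (S := S.erase e) fun st f hf =>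
      Finset.mem_erase.2 ⟨fun hfe => h.notMem_ifActive st (hfe ▸ hf),
        hS (Function.update st e true) f (by simp [h.probes_update_true, hf])⟩
    have hc := Finset.card_erase_add_one he
    simp only [depth]
    omega

/-! ### Committed edges form a matching -/

/-- Distinct edges of `M` share no endpoint. -/
def IsMatching (M : Finset (U × V)) : Prop :=
  ∀ e ∈ M, ∀ f ∈ M, e ≠ f → e.1 ≠ f.1 ∧ e.2 ≠ f.2

theorem IsMatching.commit {M : Finset (U × V)} (hM : IsMatching M) (e : U × V) :
    IsMatching (commit M e) := by
  unfold ProbingTree.commit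
  split_ifs with h
  · intro f hf f' hf' hne
    rcases Finset.mem_insert.1 hf with hfe | hfM <;>
      rcases Finset.mem_insert.1 hf' with hfe' | hfM'
    · exact absurd (hfe.trans hfe'.symm) hne
    · exact hfe ▸ ⟨(h f' hfM').1.symm, (h f' hfM').2.symm⟩
    · exact hfe' ▸ h f hfM
    · exact hM f hfM f' hfM' hne
  · exact hM

theorem IsMatching.run {st : U × V → Bool} (t : ProbingTree U V) {M : Finset (U × V)}
    (hM : IsMatching M) : IsMatching (t.run st M) := by
  induction t generalizing M with
  | halt => exact hM
  | probe e a b iha ihb =>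
    simp only [ProbingTree.run]
    split_ifs
    · exact ihb (hM.commit e)
    · exact iha hM

theorem IsMatching.card_filter_fst_le_one {M : Finset (U × V)} (hM : IsMatching M) (u : U) :
    (M.filter fun e => e.1 = u).card ≤ 1 := by
  refine Finset.card_le_one.2 fun e he f hf => ?_
  rw [Finset.mem_filter] at he hf
  by_contra hne
  exact (hM e he.1 f hf.1 hne).1 (he.2.trans hf.2.symm)

end ProbingTree

namespace StochasticGraph

open ProbingTree

variable {U V : Type*} (G : StochasticGraph U V)

/-! ### Probing a list at one online vertex -/

/-- The expected `W`-weight gained at `v` when the edges between `v` and the entries of a list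
are revealed in order until the first active one. -/
noncomputable def starValue (W : U × V → ℝ) (v : V) : List U → ℝ
  | [] => 0
  | u :: s => G.p (u, v) * W (u, v) + (1 - G.p (u, v)) * starValue W v s

theorem g_cons_zero (v : V) (u : U) (s : List U) :
    G.g v (u :: s) ⟨0, Nat.succ_pos _⟩ = G.p (u, v) := by
  have : (Finset.univ.filter fun j : Fin (u :: s).length => j < ⟨0, Nat.succ_pos _⟩) = ∅ :=
    Finset.filter_eq_empty_iff.2 fun j _ => Nat.not_lt_zero _
  rw [g, this, Finset.prod_empty, mul_one]
  rfl

theorem g_cons_succ (v : V) (u : U) (s : List U) (i : Fin s.length) :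
    G.g v (u :: s) i.succ = (1 - G.p (u, v)) * G.g v s i := by
  have : ∏ j ∈ Finset.univ.filter (fun j : Fin (s.length + 1) => j < i.succ),
      (1 - G.p ((u :: s).get j, v)) =
      (1 - G.p (u, v)) * ∏ j ∈ Finset.univ.filter (fun j => j < i), (1 - G.p (s.get j, v)) := by
    rw [Finset.prod_filter, Fin.prod_univ_succ, Finset.prod_filter]
    simp
  calc G.g v (u :: s) i.succ = G.p (s.get i, v) *
        ∏ j ∈ Finset.univ.filter (fun j : Fin (s.length + 1) => j < i.succ),
          (1 - G.p ((u :: s).get j, v)) := rfl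
    _ = _ := by rw [this, g]; ring

theorem starValue_eq_sum (W : U × V → ℝ) (v : V) (s : List U) :
    G.starValue W v s = ∑ i : Fin s.length, W (s.get i, v) * G.g v s i := by
  induction s with
  | nil => simp [starValue]
  | cons u s ih =>
    have h := Fin.sum_univ_succ
      (fun i : Fin (s.length + 1) => W ((u :: s).get i, v) * G.g v (u :: s) i)
    refine Eq.trans ?_ h.symm
    rw [starValue, ih, Finset.mul_sum]
    congr 1
    · exact (mul_comm _ _).trans (congrArg _ (G.g_cons_zero v u s).symm)
    · refine Finset.sum_congr rfl fun i _ => ?_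
      rw [g_cons_succ]
      simp only [List.get_eq_getElem, Fin.val_succ, List.getElem_cons_succ]
      ring

/-! ### Compactness of the LP polytope -/

section LinearProgram

variable [Fintype U] [DecidableEq U] [Fintype V]

theorem continuous_lpObjective : Continuous G.lpObjective := by
  unfold lpObjective
  fun_prop

theorem isCompact_lpFeasible : IsCompact {x | G.LPFeasible x} := by
  refine (isCompact_Icc (a := (0 : G.LPVar)) (b := 1)).of_isClosed_subset ?_ fun x hx => ?_
  · have : {x | G.LPFeasible x} =
        {x : G.LPVar | ∀ u : U, ∑ v, ∑ s : ProbeSeq U (G.ℓ v),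
          ∑ i ∈ Finset.univ.filter (fun i : Fin s.1.length => s.1.get i = u),
            G.g v s.1 i * x v s ≤ 1} ∩
        ({x | ∀ v : V, ∑ s : ProbeSeq U (G.ℓ v), x v s ≤ 1} ∩
          {x | ∀ (v : V) (s : ProbeSeq U (G.ℓ v)), 0 ≤ x v s}) := by
      ext x
      exact ⟨fun h => ⟨h.offline, h.online, h.nonneg⟩, fun h => ⟨h.1, h.2.1, h.2.2⟩⟩
    rw [this]
    simp only [Set.ofPred_forall]
    refine (isClosed_iInter fun u => isClosed_le (by fun_prop) continuous_const).inter
      ((isClosed_iInter fun v => isClosed_le (by fun_prop) continuous_const).inter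
        (isClosed_iInter fun v => isClosed_iInter fun s =>
          isClosed_le continuous_const (by fun_prop)))
  · exact ⟨fun v s => hx.nonneg v s, fun v s =>
      (Finset.single_le_sum (fun s' _ => hx.nonneg v s') (Finset.mem_univ s)).trans (hx.online v)⟩

theorem isGreatest_LPOPT : IsGreatest (G.lpObjective '' {x | G.LPFeasible x}) G.LPOPT := by
  have hne : {x | G.LPFeasible x}.Nonempty := ⟨0, by constructor <;> intros <;> simp⟩
  exact (G.isCompact_lpFeasible.image G.continuous_lpObjective).isGreatest_sSup (hne.image _)

end LinearProgram

theorem stateProb_nonneg [Fintype U] [Fintype V] (st : U × V → Bool) : 0 ≤ G.stateProb st :=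
  Finset.prod_nonneg fun e _ => by
    split_ifs
    · exact G.p_nonneg e
    · exact sub_nonneg.2 (G.p_le_one e)

variable [DecidableEq U] [DecidableEq V]

/-! ### Expectations over independent edge states -/

section States

variable [Fintype U] [Fintype V]

theorem sum_stateProb : ∑ st, G.stateProb st = 1 := by
  have h := Finset.prod_univ_sum (fun _ : U × V => (Finset.univ : Finset Bool))
    (fun e c => if c then G.p e else 1 - G.p e)
  simp only [Fintype.univ_bool, Finset.mem_singleton, Bool.true_eq_false, not_false_eq_true,
    Finset.sum_insert, Finset.sum_singleton, if_true, Bool.false_eq_true, if_false,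
    add_sub_cancel, Finset.prod_const_one] at h
  rw [h]
  refine Finset.sum_congr ?_ fun _ _ => rfl
  ext st
  simp [Fintype.mem_piFinset]

/-- Conditioning on the state of one edge. -/
theorem sum_stateProb_mul (e : U × V) (f : (U × V → Bool) → ℝ) :
    ∑ st, G.stateProb st * f st =
      (1 - G.p e) * ∑ st, G.stateProb st * f (Function.update st e false) +
        G.p e * ∑ st, G.stateProb st * f (Function.update st e true) := by
  classical
  set c : Bool → ℝ := fun s => if s then G.p e else 1 - G.p e with hc
  set Q : ({e' // e' ≠ e} → Bool) → ℝ := fun r =>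
    ∏ e', if r e' then G.p e' else 1 - G.p e' with hQ
  -- Split a state into its value at `e` and its restriction to the other edges; the probability
  -- factors as `c s * Q r`.
  let φ := Equiv.funSplitAt e Bool
  have key : ∀ h : (U × V → Bool) → ℝ, ∑ st, G.stateProb st * h st =
      ∑ s : Bool, ∑ r, c s * Q r * h (φ.symm (s, r)) := by
    intro h
    rw [← Fintype.sum_prod_type', ← Equiv.sum_comp φ]
    refine Finset.sum_congr rfl fun st _ => ?_
    rw [Prod.mk.eta, Equiv.symm_apply_apply]
    congr 1
    rw [stateProb, ← Fintype.prod_subtype_mul_prod_subtype (fun e' => e' = e)]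
    congr 1
    refine (Finset.prod_eq_single (⟨e, rfl⟩ : {e' // e' = e})
      (fun e' _ h => absurd (Subtype.ext e'.2) h) ?_).trans ?_
    · exact fun h => absurd (@Finset.mem_univ _ (_) _) h
    · rfl
  have hup : ∀ s s' r, Function.update (φ.symm (s, r)) e s' = φ.symm (s', r) := by
    intro s s' r
    ext e'
    by_cases h : e' = e
    · subst h; simp [φ, Equiv.funSplitAt, Equiv.piSplitAt]
    · simp [φ, h, Equiv.funSplitAt, Equiv.piSplitAt]
  rw [key, key, key]
  simp only [hup, Fintype.sum_bool, hc, if_true, Bool.false_eq_true, if_false, mul_assoc,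
    ← Finset.mul_sum]
  ring

/-- The expected `W`-weight of the final matching when `t` is executed from the matching `M`. -/
noncomputable def expWeight (W : U × V → ℝ) (t : ProbingTree U V) (M : Finset (U × V)) : ℝ :=
  ∑ st, G.stateProb st * ∑ e ∈ t.run st M, W e

theorem expWeight_halt (W : U × V → ℝ) (M : Finset (U × V)) :
    G.expWeight W halt M = ∑ e ∈ M, W e := by
  simp [expWeight, run, ← Finset.sum_mul, G.sum_stateProb]

theorem expWeight_probe (W : U × V → ℝ) {e : U × V} {a b : ProbingTree U V}
    (h : (probe e a b).NoRepeat) (M : Finset (U × V)) :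
    G.expWeight W (probe e a b) M =
      (1 - G.p e) * G.expWeight W a M + G.p e * G.expWeight W b (commit M e) := by
  simp only [expWeight]
  rw [G.sum_stateProb_mul e]
  simp only [run, Function.update_self, if_true, Bool.false_eq_true, if_false,
    run_update (h.notMem_ifInactive _), run_update (h.notMem_ifActive _)]

theorem expWeight_indicator_le_one (t : ProbingTree U V) (u : U) :
    G.expWeight (fun e => if e.1 = u then 1 else 0) t ∅ ≤ 1 := by
  refine le_of_le_of_eq ?_ G.sum_stateProb
  refine Finset.sum_le_sum fun st _ => mul_le_of_le_one_right (G.stateProb_nonneg st) ?_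
  rw [Finset.sum_boole]
  have hM : IsMatching (∅ : Finset (U × V)) := by simp [IsMatching]
  exact_mod_cast (hM.run (st := st) t).card_filter_fst_le_one u

end States

/-! ### The law of the effective probes at an online vertex -/

/-- Call a probe effective if both endpoints of the edge are unmatched when it is made. This is
the expectation over the random list of the effective probes at `v` that `t`, started from the
matching `M`, makes when all of them find inactive edges. -/
noncomputable def starExpect (v : V) :
    ProbingTree U V → Finset (U × V) → (List U → ℝ) →ₗ[ℝ] ℝ
  | halt, _ => LinearMap.proj []
  | probe e a b, M =>
    if (∀ f ∈ M, f.1 ≠ e.1 ∧ f.2 ≠ e.2) ∧ e.2 = v then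
      starExpect v a M ∘ₗ LinearMap.funLeft ℝ ℝ (List.cons e.1)
    -- Ineffective probes at `v` also land here: they are averaged over and not listed.
    else (1 - G.p e) • starExpect v a M + G.p e • starExpect v b (commit M e)

theorem starExpect_nonneg (v : V) (t : ProbingTree U V) (M : Finset (U × V))
    {f : List U → ℝ} (hf : ∀ s, 0 ≤ f s) : 0 ≤ G.starExpect v t M f := by
  induction t generalizing M f with
  | halt => exact hf []
  | probe e a b iha ihb =>
    simp only [starExpect]
    split_ifs
    · exact iha M fun s => hf _
    · exact add_nonneg (mul_nonneg (sub_nonneg.2 (G.p_le_one e)) (iha M hf))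
        (mul_nonneg (G.p_nonneg e) (ihb _ hf))

theorem starExpect_const (v : V) (t : ProbingTree U V) (M : Finset (U × V)) (c : ℝ) :
    G.starExpect v t M (fun _ => c) = c := by
  induction t generalizing M with
  | halt => rfl
  | probe e a b iha ihb =>
    simp only [starExpect]
    split_ifs
    · exact iha M
    · simp only [LinearMap.add_apply, LinearMap.smul_apply, iha, ihb, smul_eq_mul]
      ring

/-- Once `v` is matched there are no effective probes at `v`. -/
theorem starExpect_of_matched {v : V} (t : ProbingTree U V) {M : Finset (U × V)}
    (hv : ∃ f ∈ M, f.2 = v) (f : List U → ℝ) : G.starExpect v t M f = f [] := by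
  induction t generalizing M with
  | halt => rfl
  | probe e a b iha ihb =>
    have h1 : ¬((∀ f ∈ M, f.1 ≠ e.1 ∧ f.2 ≠ e.2) ∧ e.2 = v) := by
      rintro ⟨h, rfl⟩
      obtain ⟨f, hf, hfe⟩ := hv
      exact (h f hf).2 hfe
    have h2 : ∃ f ∈ commit M e, f.2 = v := by
      obtain ⟨f, hf, hfe⟩ := hv
      refine ⟨f, ?_, hfe⟩
      unfold commit
      split_ifs
      · exact Finset.mem_insert_of_mem hf
      · exact hf
    simp only [starExpect, if_neg h1, LinearMap.add_apply, LinearMap.smul_apply, iha hv, ihb h2,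
      smul_eq_mul]
    ring

/-- The functional only sees sublists of the lists of probes at `v`. -/
theorem starExpect_congr (v : V) {t : ProbingTree U V} (ht : t.NoRepeat) (M : Finset (U × V))
    {f f' : List U → ℝ}
    (h : ∀ st s, s.Sublist (((t.probes st).filter fun e => decide (e.2 = v)).map Prod.fst) →
      f s = f' s) :
    G.starExpect v t M f = G.starExpect v t M f' := by
  induction t generalizing M f f' with
  | halt => exact h (fun _ => true) [] (List.nil_sublist _)
  | probe e a b iha ihb =>
    simp only [starExpect]
    split_ifs with hc
    · refine iha ht.ifInactive M fun st s hs => h (Function.update st e false) _ ?_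
      rw [ht.probes_update_false, List.filter_cons_of_pos (by simpa using hc.2), List.map_cons]
      exact hs.cons_cons _
    · have ha : G.starExpect v a M f = G.starExpect v a M f' :=
        iha ht.ifInactive M fun st s hs => h (Function.update st e false) s <| by
          rw [ht.probes_update_false]
          exact hs.trans (((List.sublist_cons_self _ _).filter _).map _)
      have hb : G.starExpect v b (commit M e) f = G.starExpect v b (commit M e) f' :=
        ihb ht.ifActive _ fun st s hs => h (Function.update st e true) s <| by
          rw [ht.probes_update_true]
          exact hs.trans (((List.sublist_cons_self _ _).filter _).map _)
      simp only [LinearMap.add_apply, LinearMap.smul_apply, ha, hb]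

/-- The LP solution that is induced by a decision tree. -/
noncomputable def lpSolution (t : ProbingTree U V) : G.LPVar :=
  fun v s => G.starExpect v t ∅ (Pi.single s.1 1)

/-- Only lists within the patience and without repetition can occur, so `f` may be replaced by a
combination of point indicators. The empty list can occur but has no LP variable, hence `f [] = 0`.
-/
theorem starExpect_eq_sum [Fintype U] (D : G.DetAlgorithm) (v : V) {f : List U → ℝ} (hf : f [] = 0) :
    G.starExpect v D.1 ∅ f = ∑ s : ProbeSeq U (G.ℓ v), f s.1 * G.lpSolution D.1 v s := by
  have hD : D.1.NoRepeat := fun st => (D.2 st).1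
  have h : G.starExpect v D.1 ∅ f = G.starExpect v D.1 ∅
      (∑ s : ProbeSeq U (G.ℓ v), f s.1 • Pi.single s.1 (1 : ℝ)) := by
    refine G.starExpect_congr v hD ∅ fun st s hs => ?_
    simp only [Finset.sum_apply, Pi.smul_apply, smul_eq_mul, Pi.single_apply, mul_ite, mul_one,
      mul_zero]
    by_cases hne : s = []
    · subst hne
      rw [hf]
      refine (Finset.sum_eq_zero fun s' _ => if_neg fun h => ?_).symm
      have := s'.2.2.1
      simp [← h] at this
    · have hnd : s.Nodup := by
        refine List.Nodup.sublist hs (List.Nodup.map_on ?_ ((hD st).filter _))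
        intro x hx y hy hxy
        simp only [List.mem_filter, decide_eq_true_eq] at hx hy
        exact Prod.ext hxy (hx.2.trans hy.2.symm)
      have hlen : s.length ≤ G.ℓ v := by
        have h1 := hs.length_le
        rw [List.length_map, ← List.countP_eq_length_filter] at h1
        exact h1.trans ((D.2 st).2 v)
      let s₀ : ProbeSeq U (G.ℓ v) := ⟨s, hnd, List.length_pos_iff.2 hne, hlen⟩
      rw [Finset.sum_eq_single s₀]
      · simp [s₀]
      · exact fun s' _ h => if_neg fun h' => h (Subtype.ext h'.symm)
      · simp
  rw [h, map_sum]
  simp only [map_smul, smul_eq_mul, lpSolution]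

/-! ### Decomposition of the expected weight, and LP feasibility -/

variable [Fintype U] [Fintype V]

/-- The expected weight that is gained splits into the contributions of the online vertices. -/
theorem expWeight_eq (W : U × V → ℝ) {t : ProbingTree U V} (ht : t.NoRepeat)
    (M : Finset (U × V)) :
    G.expWeight W t M = ∑ e ∈ M, W e + ∑ v, G.starExpect v t M (G.starValue W v) := by
  induction t generalizing M with
  | halt => simp [expWeight_halt, starExpect, starValue]
  | probe e a b iha ihb =>
    rw [G.expWeight_probe W ht, iha ht.ifInactive, ihb ht.ifActive]
    by_cases hM : ∀ f ∈ M, f.1 ≠ e.1 ∧ f.2 ≠ e.2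
    · have he : e ∉ M := fun he => (hM e he).1 rfl
      have hcm : commit M e = insert e M := if_pos hM
      have hv : ∀ v, G.starExpect v (probe e a b) M (G.starValue W v) =
          (if v = e.2 then G.p e * W e else 0) +
            ((1 - G.p e) * G.starExpect v a M (G.starValue W v) +
              G.p e * G.starExpect v b (commit M e) (G.starValue W v)) := by
        intro v
        by_cases hev : e.2 = v
        · subst hev
          -- If `e` is active, `v` becomes matched and gains nothing more: the `b` term is
          -- `starValue` of the empty list, which is 0.
          rw [G.starExpect_of_matched b ⟨e, by simp [hcm], rfl⟩]
          have hcons : LinearMap.funLeft ℝ ℝ (List.cons e.1) (G.starValue W e.2) =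
              (fun _ => G.p e * W e) + (1 - G.p e) • G.starValue W e.2 := by
            ext s
            simp [LinearMap.funLeft_apply, starValue]
          rw [starExpect, if_pos ⟨hM, rfl⟩, LinearMap.comp_apply, hcons, map_add, map_smul,
            starExpect_const]
          simp [starValue]
        · simp [starExpect, hev, Ne.symm hev]
      simp only [hv, Finset.sum_add_distrib, Finset.sum_ite_eq', Finset.mem_univ, if_true,
        ← Finset.mul_sum]
      rw [hcm, Finset.sum_insert he]
      ring
    -- An ineffective probe changes no matching, and both sides are averaged over the state of `e`.
    · have hcm : commit M e = M := if_neg hM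
      simp only [starExpect, hM, false_and, if_false, LinearMap.add_apply, LinearMap.smul_apply,
        smul_eq_mul, Finset.sum_add_distrib, ← Finset.mul_sum, hcm]
      ring

theorem expWeight_empty (W : U × V → ℝ) (D : G.DetAlgorithm) :
    G.expWeight W D.1 ∅ = ∑ v, ∑ s : ProbeSeq U (G.ℓ v),
      (∑ i : Fin s.1.length, W (s.1.get i, v) * G.g v s.1 i) * G.lpSolution D.1 v s := by
  rw [G.expWeight_eq W fun st => (D.2 st).1, Finset.sum_empty, zero_add]
  refine Finset.sum_congr rfl fun v _ => ?_
  rw [G.starExpect_eq_sum D v rfl]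
  simp only [starValue_eq_sum]

theorem detValue_eq_lpObjective (D : G.DetAlgorithm) :
    G.detValue D = G.lpObjective (G.lpSolution D.1) :=
  G.expWeight_empty G.w D

theorem lpFeasible_lpSolution (D : G.DetAlgorithm) : G.LPFeasible (G.lpSolution D.1) where
  offline u := by
    have h := G.expWeight_indicator_le_one D.1 u
    rw [G.expWeight_empty _ D] at h
    refine le_of_eq_of_le ?_ h
    refine Finset.sum_congr rfl fun v _ => Finset.sum_congr rfl fun s _ => ?_
    rw [Finset.sum_filter, Finset.sum_mul]
    refine Finset.sum_congr rfl fun i _ => ?_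
    split_ifs <;> simp
  online v := by
    -- The test function is 1 minus the indicator of the lists that are LP variables; its mean is
    -- the slack of the constraint.
    have h := G.starExpect_nonneg v D.1 ∅
      (f := fun s => (1 : ℝ) - ∑ s' : ProbeSeq U (G.ℓ v), Pi.single (M := fun _ => ℝ) s'.1 1 s) ?_
    · have he : (fun s => (1 : ℝ) - ∑ s' : ProbeSeq U (G.ℓ v),
          Pi.single (M := fun _ => ℝ) s'.1 1 s) =
          (fun _ => 1) - ∑ s' : ProbeSeq U (G.ℓ v), Pi.single (M := fun _ => ℝ) s'.1 1 := by
        ext s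
        simp
      rw [he, map_sub, map_sum, starExpect_const] at h
      exact sub_nonneg.1 h
    · intro s
      rw [sub_nonneg]
      simp only [Pi.single_apply, Finset.sum_boole]
      have : (Finset.univ.filter fun s' : ProbeSeq U (G.ℓ v) => s = s'.1).card ≤ 1 :=
        Finset.card_le_one.2 fun x hx y hy =>
          Subtype.ext ((Finset.mem_filter.1 hx).2.symm.trans (Finset.mem_filter.1 hy).2)
      exact_mod_cast this
  nonneg v s := G.starExpect_nonneg v D.1 ∅ fun s' => by
    rw [Pi.single_apply]
    split_ifs <;> simp

/-! ### Existence of an optimal algorithm -/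

instance finite_detAlgorithm : Finite G.DetAlgorithm :=
  (Set.Finite.subset (finite_depth_le (Fintype.card (U × V))) fun _ ht =>
    NoRepeat.depth_le (S := Finset.univ) (fun st => (ht st).1)
      fun _ _ _ => Finset.mem_univ _ : {t | G.Respects t}.Finite).to_subtype

instance nonempty_detAlgorithm : Nonempty G.DetAlgorithm :=
  ⟨⟨halt, fun _ => ⟨List.nodup_nil, fun _ => Nat.zero_le _⟩⟩⟩

theorem value_pure (D : G.DetAlgorithm) : G.value (PMF.pure D) = G.detValue D := by
  classical
  refine (tsum_eq_single D fun D' h => ?_).trans ?_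
  · simp [PMF.pure_apply, h]
  · simp

theorem value_le {c : ℝ} (hc : ∀ D, G.detValue D ≤ c) (A : G.Algorithm) : G.value A ≤ c := by
  cases nonempty_fintype G.DetAlgorithm
  have hA : ∑ D, (A D).toReal = 1 := by
    rw [← ENNReal.toReal_sum fun D _ => A.apply_ne_top D, ← tsum_fintype (L := .unconditional _),
      A.tsum_coe, ENNReal.toReal_one]
  refine (tsum_fintype _).trans_le ?_
  calc ∑ D, (A D).toReal * G.detValue D ≤ ∑ D, (A D).toReal * c :=
        Finset.sum_le_sum fun D _ => mul_le_mul_of_nonneg_left (hc D) ENNReal.toReal_nonneg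
    _ = c := by rw [← Finset.sum_mul, hA, one_mul]

/-- Some deterministic algorithm is optimal among all randomized ones. -/
theorem exists_isGreatest_detValue :
    ∃ D : G.DetAlgorithm, IsGreatest (Set.range G.value) (G.detValue D) := by
  obtain ⟨D, hD⟩ := Finite.exists_max G.detValue
  refine ⟨D, ⟨_, G.value_pure D⟩, ?_⟩
  rintro _ ⟨A, rfl⟩
  exact G.value_le hD A

end StochasticGraph

theorem theorem2p1 {U V : Type*} [Fintype U] [DecidableEq U] [Fintype V] [DecidableEq V]
    (G : StochasticGraph U V) :
    IsGreatest (Set.range G.value) G.OPT ∧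
      IsGreatest (G.lpObjective '' {x | G.LPFeasible x}) G.LPOPT ∧
      G.OPT ≤ G.LPOPT := by
  obtain ⟨D, hD⟩ := G.exists_isGreatest_detValue
  have hOPT : G.OPT = G.detValue D := hD.csSup_eq
  refine ⟨hOPT ▸ hD, G.isGreatest_LPOPT, ?_⟩
  rw [hOPT, G.detValue_eq_lpObjective]
  exact G.isGreatest_LPOPT.2 ⟨_, G.lpFeasible_lpSolution D, rfl⟩
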